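/- Let $\mathcal W_0$ be the set of functions $\omega:[0,\infty)\to[0,\infty)$ that are continuous, non-decreasing, zero on $[0,1]$, tend to $+\infty$ at $+\infty$, satisfy $\log t=o(\omega(t))$ as $t\to+\infty$, and for which $y\mapsto\omega(e^y)$ is convex on $\mathbb R$. **Weights.** For a non-decreasing $\omega:[0,\infty)\to[0,\infty)$ with $\log t=o(\omega(t))$ put $\varphi^*_\omega(x):=\sup_{y\in\mathbb R}\{xy-\omega(e^y)\}$, $x\ge 0$ (for $\omega\in\mathcal W_0$ this is the supremum over $y\ge0$), and $W^{(\ell)}_p:=\exp\big(\tfrac1\ell\varphi^*_\omega(\ell p)\big)$ for $\ell>0$, $p\in\mathbb N$; the associated weight matrix of $\omega$ is $\{\mathbf W^{(\ell)}:\ell>0\}$. For a sequence $\mathbf M$ of positive reals with $M_0=1$ let $\omega_{\mathbf M}(t):=\sup_{p\in\mathbb N}\log(t^p/M_p)$, $t\ge0$ (with $0^0:=1$ and $\log 0:=-\infty$). Let $\mathbf G^\alpha:=(p!^\alpha)_p$; products of sequences are pointwise. For weight functions let $\sigma\,\check\star\,\tau(t):=\inf_{s>0}\{\sigma(s)+\tau(t/s)\}$,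 $\sigma^\iota(t):=\sigma(1/t)$, $\sigma^{\beta}(t):=\sigma(t^{\beta})$ for $\beta>0$, $\mathrm{id}^{1/\alpha}(t):=t^{1/\alpha}$, and $h_\star(t):=\inf_{u>0}\{h(u)+tu\}$. **Spaces.** For a positive sequence $w=(w_p)_p$ consider the following spaces of elements with finite norm: * $\mathcal B_w(U)$: smooth $f:U\to\mathbb C$, $U$ open in a finite-dimensional real normed space, norm $\sup_{x\in U,\,j}\|f^{(j)}(x)\|/w_j$; * $\mathcal S_w$: smooth $f$ on a finite-dimensional real normed space, norm $\sup_{x,j,k}(1+\|x\|)^k\|f^{(j)}(x)\|/w_{j+k}$; * $\mathcal A_w(S)$: holomorphic $f$ on $S$, $S$ open in the Riemann surface of the logarithm (e.g. a sector), norm $\sup_{z\in S,\,p}|f^{(p)}(z)|/w_p$; * $\Lambda_w$: complex sequences $(a_p)_{p\in\mathbb N}$, norm $\sup_p|a_p|/w_p$; * $\mathcal F_w$: complex formal power series $\sum_aF_ax^a$ in finitely many variables, norm $\sup_a|F_a|/w_{|a|}$ or, in the other usual normalization, $\sup_a a!\,|F_a|/w_{|a|}$. Here $f^{(j)}$ is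 the $j$-th Fréchet derivative. For a weight function $\omega$ with matrix $\{\mathbf W^{(\ell)}\}$, and for $\mathfrak F$ one of $\mathcal B,\mathcal S,\mathcal A,\Lambda,\mathcal F$, the Roumieu space $\mathfrak F_{\{\omega\}}$ is the locally convex inductive limit, and the Beurling space $\mathfrak F_{(\omega)}$ the projective limit, of the spaces $\mathfrak F_w$ over $w=\mathbf W^{(\ell)}$, $\ell>0$. For a weight matrix $\mathcal M=\{\mathbf M^{(x)}:x>0\}$ the spaces $\mathfrak F_{\{\mathcal M\}}$ and $\mathfrak F_{(\mathcal M)}$ are defined in the same way over $w=(h^pM^{(x)}_p)_p$, $x,h>0$. Finally, $\mathcal E_{[\cdot]}(U)$ is the projective limit of $\mathcal B_{[\cdot]}(V)$ over the open $V$ whose closure is compact and contained in $U$, along the restriction maps. The symbol $[\cdot]$ stands for either $\{\cdot\}$ or $(\cdot)$, the same one throughout. **Statement.** Let $\sigma\in\mathcal W_0$ have the associated matrix $\{\mathbf S^{(\ell)}:\ell>0\}$, let $\alpha>0$, and set $\mathcal M_\sigma\cdot\mathbf G^\alpha:=\{\mathbf S^{(\ell)}\cdot\mathbf G^\alpha:\ell>0\}$.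 Then for every $\ell>0$, for each $\mathfrak F\in\{\mathcal E,\mathcal B,\mathcal A,\mathcal S,\Lambda,\mathcal F\}$ and for both types $[\cdot]$, as locally convex vector spaces (that is, as vector spaces and with the same topology), $$\mathfrak F_{[\mathcal M_\sigma\cdot\mathbf G^\alpha]}=\mathfrak F_{[\omega_{\mathbf S^{(\ell)}\cdot\mathbf G^\alpha}]}=\mathfrak F_{[\omega_{\mathbf S^{(\ell)}}\check\star\,\omega_{\mathbf G^\alpha}]}=\mathfrak F_{[\sigma\,\check\star\,\omega_{\mathbf G^\alpha}]}=\mathfrak F_{[\sigma\,\check\star\,\mathrm{id}^{1/\alpha}]}=\mathfrak F_{[(((\sigma^\iota)^\alpha)_\star)^{1/\alpha}]}.$$ -/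

import Mathlib

open Set Filter Topology TopologicalSpace Asymptotics
open scoped Nat

universe u v

namespace WeightedSpaces

noncomputable section

/-! ### Weights

A weight function `ω : [0,∞) → [0,∞)` is a function `ℝ → ℝ` of which only the values on `[0,∞)`
are ever used. -/

/-- The set `𝒲₀` of (normalized) Braun-Meise-Taylor weight functions: continuous, non-decreasing,
zero on `[0,1]`, tending to infinity, `log t = o(ω(t))`, and `y ↦ ω(e^y)` convex. -/
structure IsBMTWeight (ω : ℝ → ℝ) : Prop where
  continuousOn : ContinuousOn ω (Ici 0)
  monotoneOn : MonotoneOn ω (Ici 0)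
  normalized : ∀ t ∈ Icc (0 : ℝ) 1, ω t = 0
  tendsto : Tendsto ω atTop atTop
  log_isLittleO : Real.log =o[atTop] ω
  convex : ConvexOn ℝ univ fun y : ℝ => ω (Real.exp y)

/-- The Legendre-Fenchel-Young conjugate `φ*_ω(x) = sup_y (x y - ω(e^y))`, `x ≥ 0`. The supremum is
over all real `y`, which is the definition for weights that need not be normalized; for a
normalized weight it is the supremum over `y ≥ 0`, see `youngConj_eq_of_normalized`. -/
def youngConj (ω : ℝ → ℝ) (x : ℝ) : ℝ := ⨆ y : ℝ, (x * y - ω (Real.exp y))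

/-- The associated weight matrix `W^(ℓ)_p = exp((1/ℓ) φ*_ω(ℓ p))`, `ℓ > 0`. -/
def assocMatrix (ω : ℝ → ℝ) (l : ℝ) (p : ℕ) : ℝ := Real.exp (1 / l * youngConj ω (l * p))

/-- The associated weight function `ω_M(t) = sup_p log(t^p / M_p)` of a weight sequence `M`,
`M_0 = 1`. For `t = 0` the value is `0`. -/
def assocFun (M : ℕ → ℝ) (t : ℝ) : ℝ := ⨆ p : ℕ, Real.log (t ^ p / M p)

/-- The Gevrey sequence `G^α = (p!^α)_p`. -/
def gevrey (α : ℝ) (p : ℕ) : ℝ := (p ! : ℝ) ^ α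

/-- The generalized lower Legendre conjugate `inf_{s > 0} (σ(s) + τ(t/s))`. -/
def lowerConj (σ τ : ℝ → ℝ) (t : ℝ) : ℝ := ⨅ s : Ioi (0 : ℝ), (σ s + τ (t / s))

/-- `id^a : t ↦ t^a`. -/
def idPow (a : ℝ) (t : ℝ) : ℝ := t ^ a

/-- `ω^ι(t) = ω(1/t)`. -/
def inversion (ω : ℝ → ℝ) (t : ℝ) : ℝ := ω (1 / t)

/-- The power substitution `ω^a(t) = ω(t^a)`. -/
def powSubst (ω : ℝ → ℝ) (a : ℝ) (t : ℝ) : ℝ := ω (t ^ a)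

/-- The lower Legendre envelope `h_⋆(t) = inf_{u > 0} (h(u) + t u)`. -/
def lowerEnvelope (h : ℝ → ℝ) (t : ℝ) : ℝ := ⨅ u : Ioi (0 : ℝ), (h u + t * u)

theorem youngConj_eq_of_normalized {ω : ℝ → ℝ} (h0 : ∀ t ∈ Icc (0 : ℝ) 1, ω t = 0)
    {x : ℝ} (hx : 0 ≤ x) : youngConj ω x = ⨆ y : Ici (0 : ℝ), (x * y - ω (Real.exp y)) := by
  have key : ∀ y : ℝ, ∃ z : Ici (0 : ℝ), x * y - ω (Real.exp y) ≤ x * z - ω (Real.exp z) := by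
    intro y
    rcases le_total 0 y with hy | hy
    · exact ⟨⟨y, hy⟩, le_rfl⟩
    · refine ⟨⟨0, mem_Ici.2 le_rfl⟩, ?_⟩
      have h1 : ω (Real.exp y) = 0 := h0 _ ⟨(Real.exp_pos y).le, Real.exp_le_one_iff.2 hy⟩
      have h2 : ω (Real.exp 0) = 0 := h0 _ (by simp)
      have : x * y ≤ 0 := mul_nonpos_of_nonneg_of_nonpos hx hy
      simp only [h1, h2]
      linarith
  unfold youngConj
  by_cases hb : BddAbove (range fun y : ℝ => x * y - ω (Real.exp y))
  · have hb' : BddAbove (range fun y : Ici (0 : ℝ) => x * (y : ℝ) - ω (Real.exp y)) :=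
      hb.mono (by rintro _ ⟨y, rfl⟩; exact ⟨y, rfl⟩)
    have : Nonempty (Ici (0 : ℝ)) := ⟨⟨0, mem_Ici.2 le_rfl⟩⟩
    apply le_antisymm
    · refine ciSup_le fun y => ?_
      obtain ⟨z, hz⟩ := key y
      exact hz.trans (le_ciSup hb' z)
    · exact ciSup_le fun y => le_ciSup hb (y : ℝ)
  · have hb' : ¬ BddAbove (range fun y : Ici (0 : ℝ) => x * (y : ℝ) - ω (Real.exp y)) := by
      rintro ⟨B, hB⟩
      refine hb ⟨B, ?_⟩
      rintro _ ⟨y, rfl⟩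
      obtain ⟨z, hz⟩ := key y
      exact hz.trans (hB ⟨z, rfl⟩)
    rw [Real.iSup_of_not_bddAbove hb, Real.iSup_of_not_bddAbove hb']

/-- The weight sequences `(h^p M^(x)_p)_p`, `x, h > 0`, in terms of which the spaces
`𝔉_[𝓜]` of a weight matrix `𝓜 = {M^(x) : x > 0}` are defined. -/
def matrixWeights (M : ℝ → ℕ → ℝ) : Set (ℕ → ℝ) :=
  {w | ∃ x > 0, ∃ h > 0, w = fun p => h ^ p * M x p}

/-- The weight sequences `(exp((1/ℓ) φ*_ω(ℓ p)))_p`, `ℓ > 0`, in terms of which the spaces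
`𝔉_[ω]` of a weight function `ω` are defined. -/
def functionWeights (ω : ℝ → ℝ) : Set (ℕ → ℝ) :=
  {w | ∃ l > 0, w = assocMatrix ω l}

/-! ### Locally convex spaces inside a vector space -/

/-- A linear subspace of `V` together with a topology on it. Two of them are equal iff the
subspaces and the topologies coincide. -/
structure TopSubspace (V : Type*) [AddCommGroup V] [Module ℂ V] where
  carrier : Submodule ℂ V
  topology : TopologicalSpace carrier

/-- The locally convex topology generated by a set of seminorms. -/
@[reducible]
def seminormTopology {W : Type*} [AddCommGroup W] [Module ℂ W] (Q : Set (Seminorm ℂ W)) :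
    TopologicalSpace W :=
  ⨅ q ∈ Q, q.toSeminormedAddCommGroup.toUniformSpace.toTopologicalSpace

/-- The two types of weighted spaces, `𝔉_{·}` and `𝔉_(·)`. -/
inductive WeightType
  | roumieu
  | beurling

section Generic

variable {V : Type*} [AddCommGroup V] [Module ℂ V] {A : Type*}

/-- The step space `{f ∈ V : sup_a s_a(f) / w_{|a|} < ∞}` of a weight sequence `w`, for a family of
seminorms `s_a` on `V`, each of some order `|a| ∈ ℕ`. (All weight sequences to which this is applied
are positive, so the absolute value only makes the definition total.) -/
def stepSpace (s : A → Seminorm ℂ V) (ord : A → ℕ) (w : ℕ → ℝ) : Submodule ℂ V where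
  carrier := {f | ∃ C : ℝ, ∀ a, s a f / |w (ord a)| ≤ C}
  zero_mem' := ⟨0, fun a => by simp⟩
  add_mem' := by
    rintro f g ⟨C, hC⟩ ⟨D, hD⟩
    refine ⟨C + D, fun a => ?_⟩
    calc s a (f + g) / |w (ord a)| ≤ (s a f + s a g) / |w (ord a)| := by
          gcongr
          exact map_add_le_add _ _ _
      _ = s a f / |w (ord a)| + s a g / |w (ord a)| := add_div _ _ _
      _ ≤ C + D := add_le_add (hC a) (hD a)
  smul_mem' := by
    rintro c f ⟨C, hC⟩
    refine ⟨‖c‖ * C, fun a => ?_⟩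
    rw [map_smul_eq_mul, mul_div_assoc]
    exact mul_le_mul_of_nonneg_left (hC a) (norm_nonneg c)

/-- The norm `sup_a s_a(f) / w_{|a|}` of the step space. -/
def stepNorm (s : A → Seminorm ℂ V) (ord : A → ℕ) (w : ℕ → ℝ) :
    Seminorm ℂ (stepSpace s ord w) :=
  Seminorm.of (fun f => ⨆ a, s a f / |w (ord a)|)
    (by
      have hb : ∀ f : stepSpace s ord w, BddAbove (range fun a => s a f / |w (ord a)|) := by
        rintro ⟨f, C, hC⟩
        exact ⟨C, by rintro _ ⟨a, rfl⟩; exact hC a⟩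
      intro f g
      refine Real.iSup_le (fun a => ?_) (add_nonneg
        (Real.iSup_nonneg fun a => div_nonneg (apply_nonneg _ _) (abs_nonneg _))
        (Real.iSup_nonneg fun a => div_nonneg (apply_nonneg _ _) (abs_nonneg _)))
      calc s a ((f + g : stepSpace s ord w) : V) / |w (ord a)|
          ≤ (s a f + s a g) / |w (ord a)| := by
            gcongr
            exact map_add_le_add _ _ _
        _ = s a f / |w (ord a)| + s a g / |w (ord a)| := add_div _ _ _
        _ ≤ _ := add_le_add (le_ciSup (hb f) a) (le_ciSup (hb g) a))
    (by
      intro c f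
      rw [Real.mul_iSup_of_nonneg (norm_nonneg c)]
      refine iSup_congr fun a => ?_
      rw [Submodule.coe_smul, map_smul_eq_mul, mul_div_assoc])

/-- The projective limit of the step spaces over all `w ∈ 𝒲`: their intersection, with the
topology given by all the norms. -/
def projLimit (s : A → Seminorm ℂ V) (ord : A → ℕ) (𝒲 : Set (ℕ → ℝ)) : TopSubspace V where
  carrier := ⨅ w : 𝒲, stepSpace s ord w
  topology := seminormTopology
    {q | ∃ w : 𝒲, q = (stepNorm s ord w).comp (Submodule.inclusion (iInf_le _ w))}

/-- The locally convex inductive limit of the step spaces over all `w ∈ 𝒲`: their sum (which is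
their union if they are directed by inclusion), with the finest locally convex topology for which
every inclusion of a step space is continuous. It is generated by all seminorms whose restriction
to each step space is continuous. -/
def indLimit (s : A → Seminorm ℂ V) (ord : A → ℕ) (𝒲 : Set (ℕ → ℝ)) : TopSubspace V where
  carrier := ⨆ w : 𝒲, stepSpace s ord w
  topology := seminormTopology
    {q | ∀ w : 𝒲, ∃ C : ℝ, ∀ f : stepSpace s ord w,
      q (Submodule.inclusion (le_iSup (fun w : 𝒲 => stepSpace s ord w) w) f)
        ≤ C * stepNorm s ord w f}

/-- Roumieu spaces are inductive limits, Beurling spaces are projective limits. -/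
def weightedSpace (t : WeightType) (s : A → Seminorm ℂ V) (ord : A → ℕ) (𝒲 : Set (ℕ → ℝ)) :
    TopSubspace V :=
  match t with
  | .roumieu => indLimit s ord 𝒲
  | .beurling => projLimit s ord 𝒲

end Generic

/-! ### Sequences and formal power series -/

/-- `Λ`: sequences of complex numbers, norms `sup_p |a_p| / w_p`. -/
def seqSpace (t : WeightType) (𝒲 : Set (ℕ → ℝ)) : TopSubspace (ℕ → ℂ) :=
  weightedSpace t (fun p : ℕ => (normSeminorm ℂ ℂ).comp (LinearMap.proj p)) id 𝒲

/-- `𝓕`: formal power series `∑_a F_a x^a` in finitely many variables, with the norms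
`sup_a |F_a| / w_{|a|}`. -/
def formalSpace (t : WeightType) (ι : Type*) (𝒲 : Set (ℕ → ℝ)) :
    TopSubspace (MvPowerSeries ι ℂ) :=
  weightedSpace t
    (fun a : ι →₀ ℕ => (normSeminorm ℂ ℂ).comp (MvPowerSeries.coeff (R := ℂ) a))
    Finsupp.degree 𝒲

/-- `𝓕` in the other usual normalization, where the growth of `a! F_a` (the derivatives at the
origin of a function with Taylor series `∑_a F_a x^a`) is measured: the norms are
`sup_a a! |F_a| / w_{|a|}`. -/
def formalTaylorSpace (t : WeightType) (ι : Type*) (𝒲 : Set (ℕ → ℝ)) :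
    TopSubspace (MvPowerSeries ι ℂ) :=
  weightedSpace t
    (fun a : ι →₀ ℕ => (normSeminorm ℂ ℂ).comp
      (((a.prod fun _ k => k ! : ℕ) : ℂ) • MvPowerSeries.coeff (R := ℂ) a))
    Finsupp.degree 𝒲

/-! ### Smooth functions -/

section Smooth

variable {E : Type*} [NormedAddCommGroup E] [NormedSpace ℝ E]

/-- The space of smooth functions `U → ℂ` on an open set `U`, each represented by its extension
by zero to the whole space. -/
def smoothFun (U : Opens E) : Submodule ℂ (E → ℂ) where
  carrier := {f | ContDiffOn ℝ (⊤ : ℕ∞) f U ∧ ∀ x ∉ U, f x = 0}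
  zero_mem' := ⟨contDiffOn_const, fun _ _ => rfl⟩
  add_mem' := fun {f g} hf hg => ⟨hf.1.add hg.1, fun x hx => by simp [hf.2 x hx, hg.2 x hx]⟩
  smul_mem' := fun c f hf => ⟨hf.1.const_smul c, fun x hx => by simp [hf.2 x hx]⟩

theorem contDiffAt_of_smoothFun {U : Opens E} (f : smoothFun U) {x : E} (hx : x ∈ U) (j : ℕ) :
    ContDiffAt ℝ j (f : E → ℂ) x :=
  ((f.2.1.contDiffAt (U.isOpen.mem_nhds hx))).of_le (by exact_mod_cast le_top)

/-- `f ↦ ‖f^(j)(x)‖`, the norm of the `j`-th Fréchet derivative at `x ∈ U`. -/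
def derivSeminorm (U : Opens E) (x : U) (j : ℕ) : Seminorm ℂ (smoothFun U) :=
  Seminorm.of (fun f => ‖iteratedFDeriv ℝ j (f : E → ℂ) (x : E)‖)
    (fun f g => by
      have := iteratedFDeriv_add_apply (contDiffAt_of_smoothFun f x.2 j) (contDiffAt_of_smoothFun g x.2 j)
      rw [Submodule.coe_add, this]
      exact norm_add_le _ _)
    (fun c f => by
      have := iteratedFDeriv_const_smul_apply (a := c) (contDiffAt_of_smoothFun f x.2 j)
      rw [Submodule.coe_smul, this, norm_smul])

/-- `𝓑(U)`: smooth functions on `U` with global bounds, norms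
`sup_{x ∈ U, j} ‖f^(j)(x)‖ / w_j`. -/
def globalSpace (t : WeightType) (U : Opens E) (𝒲 : Set (ℕ → ℝ)) : TopSubspace (smoothFun U) :=
  weightedSpace t (fun a : U × ℕ => derivSeminorm U a.1 a.2) Prod.snd 𝒲

/-- Restriction of smooth functions on `U` to a smaller open set `V`. -/
def restrict {U V : Opens E} (h : V ≤ U) : smoothFun U →ₗ[ℂ] smoothFun V where
  toFun f := ⟨(V : Set E).indicator f, by
    refine ⟨(f.2.1.mono h).congr fun x hx => indicator_of_mem hx _, fun x hx => ?_⟩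
    exact indicator_of_notMem hx _⟩
  map_add' f g := by
    ext x
    by_cases hx : x ∈ (V : Set E) <;> simp [hx]
  map_smul' c f := by
    ext x
    by_cases hx : x ∈ (V : Set E) <;> simp [hx]

/-- The relatively compact open subsets of `U`, i.e. those whose closure is a compact subset
of `U`. -/
structure RelCompact {E : Type*} [NormedAddCommGroup E] (U : Opens E) where
  set : Opens E
  isCompact : IsCompact (closure (set : Set E))
  subset : closure (set : Set E) ⊆ U

theorem RelCompact.le {E : Type*} [NormedAddCommGroup E] {U : Opens E} (V : RelCompact U) : V.set ≤ U :=
  fun _ hx => V.subset (subset_closure hx)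

/-- `𝓔(U)`: ultradifferentiable functions on `U` with local bounds. It is the projective limit,
over the relatively compact open sets `V` in `U` and along the restriction maps, of the spaces
with uniform bounds on `V` (equivalently, of the spaces on compact sets with smooth boundary). -/
def localSpace (t : WeightType) (U : Opens E) (𝒲 : Set (ℕ → ℝ)) : TopSubspace (smoothFun U) where
  carrier := ⨅ V : RelCompact U, (globalSpace t V.set 𝒲).carrier.comap (restrict V.le)
  topology := ⨅ V : RelCompact U, (globalSpace t V.set 𝒲).topology.induced fun f =>
    ⟨restrict V.le f.1, (Submodule.mem_iInf _).1 f.2 V⟩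

/-- `𝓢`: Gelfand-Shilov spaces of smooth functions on the whole space, norms
`sup_{x, j, k} (1 + ‖x‖)^k ‖f^(j)(x)‖ / w_{j+k}`. -/
def gelfandShilovSpace (t : WeightType) (E : Type*) [NormedAddCommGroup E] [NormedSpace ℝ E]
    (𝒲 : Set (ℕ → ℝ)) : TopSubspace (smoothFun (⊤ : Opens E)) :=
  weightedSpace t
    (fun a : (⊤ : Opens E) × ℕ × ℕ =>
      ((1 + ‖(a.1 : E)‖₊) ^ a.2.2) • derivSeminorm (⊤ : Opens E) a.1 a.2.1)
    (fun a => a.2.1 + a.2.2) 𝒲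

end Smooth

/-! ### Holomorphic functions on the Riemann surface of the logarithm

The Riemann surface of the logarithm is identified with `ℂ` by the coordinate `ζ = log z`. In this
coordinate the (unbounded) sector of opening `γπ` bisected by the direction `d` is the strip
`|Im ζ - d| < γπ/2`, and a function is holomorphic on an open subset of the surface iff it is
holomorphic in `ζ`. -/

/-- The derivative with respect to `z = e^ζ`, in the coordinate `ζ`. -/
def zDeriv (f : ℂ → ℂ) (ζ : ℂ) : ℂ := Complex.exp (-ζ) * deriv f ζ

/-- The space of holomorphic functions on an open subset `S` of the surface, each represented by
its extension by zero. -/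
def holoFun (S : Opens ℂ) : Submodule ℂ (ℂ → ℂ) where
  carrier := {f | DifferentiableOn ℂ f S ∧ ∀ ζ ∉ S, f ζ = 0}
  zero_mem' := ⟨differentiableOn_const _, fun _ _ => rfl⟩
  add_mem' := fun {f g} hf hg => ⟨hf.1.add hg.1, fun x hx => by simp [hf.2 x hx, hg.2 x hx]⟩
  smul_mem' := fun c f hf => ⟨hf.1.const_smul c, fun x hx => by simp [hf.2 x hx]⟩

theorem differentiableOn_zDeriv_iterate {S : Opens ℂ} {f : ℂ → ℂ} (hf : DifferentiableOn ℂ f S)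
    (p : ℕ) : DifferentiableOn ℂ (zDeriv^[p] f) S := by
  induction p with
  | zero => exact hf
  | succ p ih =>
    rw [Function.iterate_succ_apply']
    exact (by fun_prop : DifferentiableOn ℂ (fun ζ : ℂ => Complex.exp (-ζ)) S).mul
      (ih.deriv S.isOpen)

theorem zDeriv_congr {S : Opens ℂ} {f g : ℂ → ℂ} (h : EqOn f g S) :
    EqOn (zDeriv f) (zDeriv g) S := fun ζ hζ => by
  have : f =ᶠ[𝓝 ζ] g := Filter.eventuallyEq_of_mem (S.isOpen.mem_nhds hζ) h
  simp only [zDeriv, this.deriv_eq]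

theorem zDeriv_iterate_add {S : Opens ℂ} {f g : ℂ → ℂ} (hf : DifferentiableOn ℂ f S)
    (hg : DifferentiableOn ℂ g S) (p : ℕ) :
    EqOn (zDeriv^[p] (f + g)) (zDeriv^[p] f + zDeriv^[p] g) S := by
  induction p with
  | zero => exact fun _ _ => rfl
  | succ p ih =>
    intro ζ hζ
    have h1 := (differentiableOn_zDeriv_iterate hf p).differentiableAt (S.isOpen.mem_nhds hζ)
    have h2 := (differentiableOn_zDeriv_iterate hg p).differentiableAt (S.isOpen.mem_nhds hζ)
    simp only [Function.iterate_succ_apply', Pi.add_apply]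
    rw [zDeriv_congr ih hζ, zDeriv, deriv_add h1 h2, mul_add]
    rfl

theorem zDeriv_iterate_smul (c : ℂ) (f : ℂ → ℂ) (p : ℕ) :
    zDeriv^[p] (c • f) = c • zDeriv^[p] f := by
  induction p with
  | zero => rfl
  | succ p ih =>
    rw [Function.iterate_succ_apply', Function.iterate_succ_apply', ih]
    ext ζ
    simp only [zDeriv, Pi.smul_apply, smul_eq_mul, deriv_const_smul_field]
    ring

/-- `f ↦ |f^(p)(z)|` at the point `z` of `S` with coordinate `ζ`. -/
def holoSeminorm (S : Opens ℂ) (ζ : S) (p : ℕ) : Seminorm ℂ (holoFun S) :=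
  Seminorm.of (fun f => ‖(zDeriv^[p] (f : ℂ → ℂ)) ζ‖)
    (fun f g => by
      rw [Submodule.coe_add, zDeriv_iterate_add f.2.1 g.2.1 p ζ.2]
      exact norm_add_le _ _)
    (fun c f => by
      rw [Submodule.coe_smul, zDeriv_iterate_smul]
      exact norm_smul c _)

/-- `𝓐(S)`: ultraholomorphic functions on `S`, norms `sup_{z ∈ S, p} |f^(p)(z)| / w_p`. -/
def ultraholomorphicSpace (t : WeightType) (S : Opens ℂ) (𝒲 : Set (ℕ → ℝ)) :
    TopSubspace (holoFun S) :=
  weightedSpace t (fun a : S × ℕ => holoSeminorm S a.1 a.2) Prod.snd 𝒲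

/-! ### Equality of the weighted spaces -/

/-- `𝔉_[𝒲] = 𝔉_[𝒲']` as locally convex vector spaces for each `𝔉 ∈ {𝓔, 𝓑, 𝓐, 𝓢, Λ, 𝓕}`, on all
domains, in the Roumieu case as well as in the Beurling case. -/
def SameSpaces (𝒲 𝒲' : Set (ℕ → ℝ)) : Prop :=
  ∀ t : WeightType,
    (∀ (E : Type u) [NormedAddCommGroup E] [NormedSpace ℝ E] [FiniteDimensional ℝ E],
      (∀ U : Opens E, localSpace t U 𝒲 = localSpace t U 𝒲') ∧
      (∀ U : Opens E, globalSpace t U 𝒲 = globalSpace t U 𝒲') ∧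
      gelfandShilovSpace t E 𝒲 = gelfandShilovSpace t E 𝒲') ∧
    (∀ S : Opens ℂ, ultraholomorphicSpace t S 𝒲 = ultraholomorphicSpace t S 𝒲') ∧
    seqSpace t 𝒲 = seqSpace t 𝒲' ∧
    (∀ (ι : Type v) [Finite ι],
      formalSpace t ι 𝒲 = formalSpace t ι 𝒲' ∧
      formalTaylorSpace t ι 𝒲 = formalTaylorSpace t ι 𝒲')

end

end WeightedSpaces

open WeightedSpaces

/-! Each space depends on its set of weight sequences only up to mutual domination. If every `w ∈ 𝒲`
is dominated by some `w' ∈ 𝒲'` and every `w' ∈ 𝒲'` dominates some `w ∈ 𝒲`, the Roumieu and Beurling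
spaces of `𝒲` embed continuously in those of `𝒲'`, so everything reduces to estimates of sequences
(`WeightsLE.sameSpaces`).

These estimates come from the Young conjugate, which turns `lowerConj` into a sum
(`youngConj_lowerConj`). Both `id^(1/α)` and the associated function of `p!^α` have a conjugate
equal to `α x log x` up to `O(x) + O(1)`. Hence for each `ω` in the chain, `φ*_ω(x)` lies between
expressions `(1/b) φ*_σ(b x) + α x log(e x) ± C`. For `ω_{S^(l)}` the two bounds have different `b`,
because passing from integer to real arguments doubles the index.

At `x = k p`, after division by `k`, such an expression becomes `log S^(bk)_p + α p log(e k p) ±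
C/k`. By Stirling this is the logarithm of `h^p S^(bk)_p p!^α` with `h` a multiple of `k^α`. The
index and the geometric factor both grow with `k` from `0` to `∞`, so this one-parameter family is
equivalent to the full matrix with independent `x` and `h` (`weightsLE_matrixWeights`,
`matrixWeights_weightsLE`). All members of the chain are compared through that matrix. -/

namespace WeightedSpaces

/-! ### Comparison of the spaces -/

section Comparison

/-- `w` is positive and bounded by a multiple of `w'`. -/
def Dominated (w w' : ℕ → ℝ) : Prop :=
  ∃ C > 0, ∀ p, 0 < w p ∧ w p ≤ C * w' p

/-- Each weight sequence of `𝒲` is dominated by one of `𝒲'`, and each one of `𝒲'` dominates one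
of `𝒲`. -/
structure WeightsLE (𝒲 𝒲' : Set (ℕ → ℝ)) : Prop where
  roumieu : ∀ w ∈ 𝒲, ∃ w' ∈ 𝒲', Dominated w w'
  beurling : ∀ w' ∈ 𝒲', ∃ w ∈ 𝒲, Dominated w w'

theorem Dominated.trans {w₁ w₂ w₃ : ℕ → ℝ} (h : Dominated w₁ w₂) (h' : Dominated w₂ w₃) :
    Dominated w₁ w₃ := by
  obtain ⟨C, hC, h⟩ := h
  obtain ⟨D, hD, h'⟩ := h'
  refine ⟨C * D, mul_pos hC hD, fun p => ⟨(h p).1, (h p).2.trans ?_⟩⟩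
  rw [mul_assoc]
  exact mul_le_mul_of_nonneg_left (h' p).2 hC.le

theorem WeightsLE.trans {𝒲₁ 𝒲₂ 𝒲₃ : Set (ℕ → ℝ)} (h : WeightsLE 𝒲₁ 𝒲₂) (h' : WeightsLE 𝒲₂ 𝒲₃) :
    WeightsLE 𝒲₁ 𝒲₃ where
  roumieu w hw := by
    obtain ⟨w', hw', d⟩ := h.roumieu w hw
    obtain ⟨w'', hw'', d'⟩ := h'.roumieu w' hw'
    exact ⟨w'', hw'', d.trans d'⟩
  beurling w hw := by
    obtain ⟨w', hw', d⟩ := h'.beurling w hw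
    obtain ⟨w'', hw'', d'⟩ := h.beurling w' hw'
    exact ⟨w'', hw'', d'.trans d⟩

/-- Positivity of `w' p` is forced by `0 < w p ≤ C * w' p`, so the absolute values in the norms
disappear. -/
theorem Dominated.div_le {w w' : ℕ → ℝ} {C : ℝ} {p : ℕ} (hw : 0 < w p) (h : w p ≤ C * w' p)
    (hC : 0 < C) {r : ℝ} (hr : 0 ≤ r) : r / |w' p| ≤ C * (r / |w p|) := by
  have hw' : 0 < w' p := by
    by_contra! h0
    exact absurd (h.trans (mul_nonpos_of_nonneg_of_nonpos hC.le h0)) (not_le.2 hw)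
  rw [abs_of_pos hw, abs_of_pos hw', ← mul_div_assoc, div_le_div_iff₀ hw' hw]
  calc r * w p ≤ r * (C * w' p) := mul_le_mul_of_nonneg_left h hr
    _ = C * r * w' p := by ring

/-- Continuous inclusion of one topologized linear subspace in another one. -/
def TopSubspace.ContIncl {V : Type*} [AddCommGroup V] [Module ℂ V] (X Y : TopSubspace V) : Prop :=
  ∃ h : X.carrier ≤ Y.carrier, X.topology ≤ Y.topology.induced (Submodule.inclusion h)

theorem TopSubspace.ContIncl.antisymm {V : Type*} [AddCommGroup V] [Module ℂ V]
    {X Y : TopSubspace V} (h : X.ContIncl Y) (h' : Y.ContIncl X) : X = Y := by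
  obtain ⟨S, τ⟩ := X
  obtain ⟨T, τ'⟩ := Y
  obtain ⟨h₁, h₂⟩ := h
  obtain ⟨h₁', h₂'⟩ := h'
  obtain rfl : S = T := le_antisymm h₁ h₁'
  replace h₂ : τ ≤ τ' := h₂.trans_eq (@induced_id S τ')
  replace h₂' : τ' ≤ τ := h₂'.trans_eq (@induced_id S τ)
  obtain rfl : τ = τ' := le_antisymm h₂ h₂'
  rfl

/-- Inducing commutes with infima of topologies, so one target seminorm can be treated at a time, as
a bounded linear map of seminormed spaces. -/
theorem seminormTopology_le_induced {W W' : Type*} [AddCommGroup W] [Module ℂ W]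
    [AddCommGroup W'] [Module ℂ W'] {Q : Set (Seminorm ℂ W)} {Q' : Set (Seminorm ℂ W')}
    (f : W →ₗ[ℂ] W') (h : ∀ q' ∈ Q', ∃ q ∈ Q, ∃ C : ℝ, ∀ x, q' (f x) ≤ C * q x) :
    seminormTopology Q ≤ (seminormTopology Q').induced f := by
  unfold seminormTopology
  simp only [induced_iInf]
  refine le_iInf₂ fun q' hq' => ?_
  obtain ⟨q, hq, C, hC⟩ := h q' hq'
  refine (iInf₂_le q hq).trans ?_
  rw [← continuous_iff_le_induced]
  let := q.toSeminormedAddCommGroup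
  let := q'.toSeminormedAddCommGroup
  exact AddMonoidHomClass.continuous_of_bound f C hC

variable {V : Type*} [AddCommGroup V] [Module ℂ V] {A : Type*}

theorem stepSpace_mono (s : A → Seminorm ℂ V) (ord : A → ℕ) {w w' : ℕ → ℝ}
    (h : Dominated w w') : stepSpace s ord w ≤ stepSpace s ord w' := by
  obtain ⟨C, hC, h⟩ := h
  rintro f ⟨D, hD⟩
  exact ⟨C * D, fun a => (Dominated.div_le (h _).1 (h _).2 hC (apply_nonneg _ _)).trans
    (mul_le_mul_of_nonneg_left (hD a) hC.le)⟩

theorem stepNorm_le (s : A → Seminorm ℂ V) (ord : A → ℕ) {w w' : ℕ → ℝ}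
    (h : Dominated w w') : ∃ C : ℝ, ∀ (f : V) (hf : f ∈ stepSpace s ord w)
      (hf' : f ∈ stepSpace s ord w'),
      stepNorm s ord w' ⟨f, hf'⟩ ≤ C * stepNorm s ord w ⟨f, hf⟩ := by
  obtain ⟨C, hC, h⟩ := h
  refine ⟨C, fun f hf hf' => ?_⟩
  change (⨆ a, s a f / |w' (ord a)|) ≤ C * ⨆ a, s a f / |w (ord a)|
  have hb : BddAbove (range fun a => s a f / |w (ord a)|) := by
    obtain ⟨D, hD⟩ := hf
    exact ⟨D, by rintro _ ⟨a, rfl⟩; exact hD a⟩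
  refine Real.iSup_le (fun a => ?_) (mul_nonneg hC.le
    (Real.iSup_nonneg fun a => div_nonneg (apply_nonneg _ _) (abs_nonneg _)))
  exact (Dominated.div_le (h _).1 (h _).2 hC (apply_nonneg _ _)).trans
    (mul_le_mul_of_nonneg_left (le_ciSup hb a) hC.le)

theorem projLimit_contIncl (s : A → Seminorm ℂ V) (ord : A → ℕ) {𝒲 𝒲' : Set (ℕ → ℝ)}
    (h : ∀ w' ∈ 𝒲', ∃ w ∈ 𝒲, Dominated w w') :
    (projLimit s ord 𝒲).ContIncl (projLimit s ord 𝒲') := by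
  have hle : (projLimit s ord 𝒲).carrier ≤ (projLimit s ord 𝒲').carrier := by
    refine le_iInf fun w' => ?_
    obtain ⟨w, hw, d⟩ := h w' w'.2
    exact (iInf_le _ (⟨w, hw⟩ : 𝒲)).trans (stepSpace_mono s ord d)
  refine ⟨hle, seminormTopology_le_induced (Submodule.inclusion hle) ?_⟩
  rintro q' ⟨w', rfl⟩
  obtain ⟨w, hw, d⟩ := h w' w'.2
  obtain ⟨C, hC⟩ := stepNorm_le s ord d
  exact ⟨_, ⟨⟨w, hw⟩, rfl⟩, C, fun f => hC _ _ _⟩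

theorem indLimit_contIncl (s : A → Seminorm ℂ V) (ord : A → ℕ) {𝒲 𝒲' : Set (ℕ → ℝ)}
    (h : ∀ w ∈ 𝒲, ∃ w' ∈ 𝒲', Dominated w w') :
    (indLimit s ord 𝒲).ContIncl (indLimit s ord 𝒲') := by
  have hle : (indLimit s ord 𝒲).carrier ≤ (indLimit s ord 𝒲').carrier := by
    refine iSup_le fun w => ?_
    obtain ⟨w', hw', d⟩ := h w w.2
    exact (stepSpace_mono s ord d).trans
      (le_iSup (fun w : 𝒲' => stepSpace s ord w) ⟨w', hw'⟩)
  refine ⟨hle, seminormTopology_le_induced (Submodule.inclusion hle) ?_⟩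
  intro q' hq'
  -- The pullback of `q'` is itself a generating seminorm of the source, since it is bounded on
  -- every step space.
  refine ⟨q'.comp (Submodule.inclusion hle), fun w => ?_, 1, fun x => (one_mul _).ge⟩
  obtain ⟨w', hw', d⟩ := h w w.2
  obtain ⟨C, hC⟩ := stepNorm_le s ord d
  obtain ⟨D, hD⟩ := hq' ⟨w', hw'⟩
  -- The constant `D` is not known to be nonnegative.
  refine ⟨|D| * C, fun f => ?_⟩
  have hf' := stepSpace_mono s ord d f.2
  calc _ ≤ D * stepNorm s ord w' ⟨f, hf'⟩ := hD ⟨f, hf'⟩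
    _ ≤ |D| * stepNorm s ord w' ⟨f, hf'⟩ :=
      mul_le_mul_of_nonneg_right (le_abs_self D) (apply_nonneg _ _)
    _ ≤ |D| * (C * stepNorm s ord w f) :=
      mul_le_mul_of_nonneg_left (hC f f.2 hf') (abs_nonneg D)
    _ = _ := by ring

theorem weightedSpace_contIncl (t : WeightType) (s : A → Seminorm ℂ V) (ord : A → ℕ)
    {𝒲 𝒲' : Set (ℕ → ℝ)} (h : WeightsLE 𝒲 𝒲') :
    (weightedSpace t s ord 𝒲).ContIncl (weightedSpace t s ord 𝒲') := by
  cases t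
  · exact indLimit_contIncl s ord h.roumieu
  · exact projLimit_contIncl s ord h.beurling

theorem le_induced_iInf {X Y ι : Type*} {τ : TopologicalSpace X} {τ' : ι → TopologicalSpace Y}
    {g : X → Y} (h : ∀ i, τ ≤ (τ' i).induced g) : τ ≤ (⨅ i, τ' i).induced g := by
  rw [induced_iInf]
  exact le_iInf h

theorem induced_le_of_comp_eq {X Y Z Z' : Type*} {τ : TopologicalSpace Z'} {f : X → Z} {g : Z → Z'}
    {g' : X → Y} {f' : Y → Z'} (h : ∀ x, g (f x) = f' (g' x)) :
    (τ.induced g).induced f ≤ (τ.induced f').induced g' := by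
  rw [induced_compose, induced_compose, show g ∘ f = f' ∘ g' from funext h]

theorem localSpace_contIncl {E : Type*} [NormedAddCommGroup E] [NormedSpace ℝ E] (t : WeightType)
    (U : Opens E) {𝒲 𝒲' : Set (ℕ → ℝ)} (h : WeightsLE 𝒲 𝒲') :
    (localSpace t U 𝒲).ContIncl (localSpace t U 𝒲') := by
  have hg : ∀ V : RelCompact U, (globalSpace t V.set 𝒲).ContIncl (globalSpace t V.set 𝒲') :=
    fun V => weightedSpace_contIncl t _ _ h
  have hle : (localSpace t U 𝒲).carrier ≤ (localSpace t U 𝒲').carrier :=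
    iInf_mono fun V => Submodule.comap_mono (hg V).1
  refine ⟨hle, ?_⟩
  have hτ : ∀ V : RelCompact U, (localSpace t U 𝒲).topology ≤
      (globalSpace t V.set 𝒲).topology.induced fun f =>
        ⟨restrict V.le f.1, (Submodule.mem_iInf _).1 f.2 V⟩ := fun V => iInf_le _ V
  refine le_induced_iInf fun V => ((hτ V).trans (induced_mono (hg V).2)).trans ?_
  -- Restriction to `V` commutes with the inclusions.
  exact induced_le_of_comp_eq fun f => Subtype.ext rfl

theorem WeightsLE.sameSpaces {𝒲 𝒲' : Set (ℕ → ℝ)} (h : WeightsLE 𝒲 𝒲') (h' : WeightsLE 𝒲' 𝒲) :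
    SameSpaces.{u, v} 𝒲 𝒲' := by
  exact fun t => ⟨fun E _ _ _ =>
    ⟨fun U => (localSpace_contIncl t U h).antisymm (localSpace_contIncl t U h'),
      fun U => (weightedSpace_contIncl t _ _ h).antisymm (weightedSpace_contIncl t _ _ h'),
      (weightedSpace_contIncl t _ _ h).antisymm (weightedSpace_contIncl t _ _ h')⟩,
    fun S => (weightedSpace_contIncl t _ _ h).antisymm (weightedSpace_contIncl t _ _ h'),
    (weightedSpace_contIncl t _ _ h).antisymm (weightedSpace_contIncl t _ _ h'),
    fun ι _ => ⟨(weightedSpace_contIncl t _ _ h).antisymm (weightedSpace_contIncl t _ _ h'),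
      (weightedSpace_contIncl t _ _ h).antisymm (weightedSpace_contIncl t _ _ h')⟩⟩

end Comparison

end WeightedSpaces
namespace WeightedSpaces

/-! ### Conjugates of weight functions -/

section Conjugates

/-- The supremum that defines the conjugate of `ω` is finite. -/
def HasConj (ω : ℝ → ℝ) : Prop :=
  ∀ x, 0 ≤ x → BddAbove (range fun y : ℝ => x * y - ω (Real.exp y))

theorem HasConj.le {ω : ℝ → ℝ} (h : HasConj ω) {x : ℝ} (hx : 0 ≤ x) (y : ℝ) :
    x * y - ω (Real.exp y) ≤ youngConj ω x :=
  le_ciSup (h x hx) y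

theorem HasConj.le_log {ω : ℝ → ℝ} (h : HasConj ω) {x : ℝ} (hx : 0 ≤ x) {t : ℝ} (ht : 0 < t) :
    x * Real.log t - ω t ≤ youngConj ω x := by
  simpa [Real.exp_log ht] using h.le hx (Real.log t)

theorem youngConj_anti {ω τ : ℝ → ℝ} (h : HasConj ω) (hle : ∀ t > 0, ω t ≤ τ t) {x : ℝ}
    (hx : 0 ≤ x) : youngConj τ x ≤ youngConj ω x :=
  ciSup_le fun y => (sub_le_sub_left (hle _ (Real.exp_pos y)) _).trans (h.le hx y)

theorem bddBelow_lowerConj {σ τ : ℝ → ℝ} (hσ0 : ∀ t > 0, 0 ≤ σ t) (hτ0 : ∀ t > 0, 0 ≤ τ t) {t : ℝ}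
    (ht : 0 < t) : BddBelow (range fun s : Ioi (0 : ℝ) => σ s + τ (t / s)) :=
  ⟨0, by rintro _ ⟨s, rfl⟩; exact add_nonneg (hσ0 _ s.2) (hτ0 _ (div_pos ht s.2))⟩

/-- Split `y = log s + log (e^y / s)` and apply Young's inequality to each summand. -/
theorem lowerConj_bound {σ τ : ℝ → ℝ} (hσ : HasConj σ) (hτ : HasConj τ) {x : ℝ} (hx : 0 ≤ x)
    (y : ℝ) : x * y - lowerConj σ τ (Real.exp y) ≤ youngConj σ x + youngConj τ x := by
  have : Nonempty (Ioi (0 : ℝ)) := ⟨⟨1, mem_Ioi.2 one_pos⟩⟩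
  suffices h : x * y - (youngConj σ x + youngConj τ x) ≤ lowerConj σ τ (Real.exp y) by linarith
  refine le_ciInf fun s => ?_
  have hs : (0 : ℝ) < s := s.2
  have h1 := hσ.le_log hx hs
  have h2 := hτ.le_log hx (div_pos (Real.exp_pos y) hs)
  rw [Real.log_div (Real.exp_pos y).ne' hs.ne', Real.log_exp] at h2
  linarith

theorem HasConj.lowerConj {σ τ : ℝ → ℝ} (hσ : HasConj σ) (hτ : HasConj τ) :
    HasConj (lowerConj σ τ) := fun x hx =>
  ⟨_, by rintro _ ⟨y, rfl⟩; exact lowerConj_bound hσ hτ hx y⟩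

/-- The Young conjugate turns the operation `lowerConj` into a sum. -/
theorem youngConj_lowerConj {σ τ : ℝ → ℝ} (hσ0 : ∀ t > 0, 0 ≤ σ t) (hτ0 : ∀ t > 0, 0 ≤ τ t)
    (hσ : HasConj σ) (hτ : HasConj τ) {x : ℝ} (hx : 0 ≤ x) :
    youngConj (lowerConj σ τ) x = youngConj σ x + youngConj τ x := by
  refine le_antisymm (ciSup_le (lowerConj_bound hσ hτ hx)) ?_
  -- The pair `u, v` is the choice `t = e^(u+v)`, `s = e^u` in the infimum; as `u` and `v` are
  -- independent, the two suprema can then be taken separately.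
  have key : ∀ u v : ℝ, (x * u - σ (Real.exp u)) + (x * v - τ (Real.exp v)) ≤
      youngConj (lowerConj σ τ) x := by
    intro u v
    have h1 := (hσ.lowerConj hτ).le hx (u + v)
    have h2 : lowerConj σ τ (Real.exp (u + v)) ≤ σ (Real.exp u) + τ (Real.exp v) := by
      have := ciInf_le (bddBelow_lowerConj hσ0 hτ0 (Real.exp_pos (u + v)))
        (⟨Real.exp u, Real.exp_pos u⟩ : Ioi (0 : ℝ))
      rwa [← Real.exp_sub, add_sub_cancel_left] at this
    linarith
  have h1 : ∀ v : ℝ, youngConj σ x ≤ youngConj (lowerConj σ τ) x - (x * v - τ (Real.exp v)) :=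
    fun v => ciSup_le fun u => by linarith [key u v]
  have h2 : youngConj τ x ≤ youngConj (lowerConj σ τ) x - youngConj σ x :=
    ciSup_le fun v => by linarith [h1 v]
  linarith

theorem youngConj_congr {ω τ : ℝ → ℝ} (h : ∀ t > 0, ω t = τ t) : youngConj ω = youngConj τ :=
  funext fun x => by simp only [youngConj, h _ (Real.exp_pos _)]

/-- Midpoint convexity of a supremum of affine functions. It lets a bounded shift of the argument be
traded for a doubled index. -/
theorem youngConj_add_le {ω : ℝ → ℝ} (h : HasConj ω) {x y : ℝ} (hx : 0 ≤ x) (hy : 0 ≤ y) :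
    youngConj ω (x + y) ≤ 1 / 2 * youngConj ω (2 * x) + 1 / 2 * youngConj ω (2 * y) :=
  ciSup_le fun z => by
    have h1 := h.le (mul_nonneg zero_le_two hx) z
    have h2 := h.le (mul_nonneg zero_le_two hy) z
    linarith

/-- The functions `(1/l) φ*(l x)` increase with `l`. -/
theorem youngConj_scale_mono {ω : ℝ → ℝ} (h0 : ∀ t > 0, 0 ≤ ω t) (h : HasConj ω) {k l : ℝ}
    (hk : 0 < k) (hkl : k ≤ l) {x : ℝ} (hx : 0 ≤ x) :
    1 / k * youngConj ω (k * x) ≤ 1 / l * youngConj ω (l * x) := by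
  have hl : 0 < l := hk.trans_le hkl
  suffices H : youngConj ω (k * x) ≤ k * (1 / l * youngConj ω (l * x)) by
    rw [one_div, inv_mul_le_iff₀ hk]; exact H
  refine ciSup_le fun y => ?_
  have h1 := h.le (mul_nonneg hl.le hx) y
  have h2 := h0 _ (Real.exp_pos y)
  -- Scaling by `k / l ≤ 1` also shrinks the subtracted `ω`, which is harmless since `ω ≥ 0`.
  have h3 : k / l * (l * x * y - ω (Real.exp y)) ≤ k / l * youngConj ω (l * x) :=
    mul_le_mul_of_nonneg_left h1 (by positivity)
  have h4 : k / l * ω (Real.exp y) ≤ ω (Real.exp y) :=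
    mul_le_of_le_one_left h2 ((div_le_one hl).2 hkl)
  have h5 : k / l * (l * x * y - ω (Real.exp y)) = k * x * y - k / l * ω (Real.exp y) := by
    field_simp
  have h6 : k * (1 / l * youngConj ω (l * x)) = k / l * youngConj ω (l * x) := by ring
  linarith

end Conjugates

/-! ### Associated weight functions of sequences -/

section Sequences

/-- A weight sequence with a finite associated weight function. -/
structure IsWeightSeq (M : ℕ → ℝ) : Prop where
  one_le : ∀ p, 1 ≤ M p
  zero : M 0 = 1
  bdd : ∀ t > 0, BddAbove (range fun p : ℕ => Real.log (t ^ p / M p))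

theorem IsWeightSeq.pos {M : ℕ → ℝ} (h : IsWeightSeq M) (p : ℕ) : 0 < M p :=
  one_pos.trans_le (h.one_le p)

theorem IsWeightSeq.log_le {M : ℕ → ℝ} (h : IsWeightSeq M) {t : ℝ} (ht : 0 < t) (p : ℕ) :
    p * Real.log t - Real.log (M p) ≤ assocFun M t := by
  have := le_ciSup (h.bdd t ht) p
  rwa [Real.log_div (pow_pos ht p).ne' (h.pos p).ne', Real.log_pow] at this

theorem IsWeightSeq.assocFun_le {M : ℕ → ℝ} (h : IsWeightSeq M) {t B : ℝ} (ht : 0 < t)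
    (hB : ∀ p : ℕ, p * Real.log t - Real.log (M p) ≤ B) : assocFun M t ≤ B :=
  ciSup_le fun p => by
    rw [Real.log_div (pow_pos ht p).ne' (h.pos p).ne', Real.log_pow]
    exact hB p

theorem IsWeightSeq.assocFun_nonneg {M : ℕ → ℝ} (h : IsWeightSeq M) {t : ℝ} (ht : 0 < t) :
    0 ≤ assocFun M t := by
  simpa [h.zero] using h.log_le ht 0

/-- For `y ≥ 0` raising `x` to the integer `q` only helps; for `y ≤ 0` the left side is nonpositive
and `log (M q) ≥ 0`. -/
theorem IsWeightSeq.conj_bound {M : ℕ → ℝ} (h : IsWeightSeq M) {x : ℝ} (hx : 0 ≤ x) {q : ℕ}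
    (hq : x ≤ q) (y : ℝ) : x * y - assocFun M (Real.exp y) ≤ Real.log (M q) := by
  rcases le_total 0 y with hy | hy
  · have := h.log_le (Real.exp_pos y) q
    rw [Real.log_exp] at this
    have := mul_le_mul_of_nonneg_right hq hy
    linarith
  · have h1 := h.assocFun_nonneg (Real.exp_pos y)
    have h2 := mul_nonpos_of_nonneg_of_nonpos hx hy
    have h3 := Real.log_nonneg (h.one_le q)
    linarith

theorem IsWeightSeq.hasConj {M : ℕ → ℝ} (h : IsWeightSeq M) : HasConj (assocFun M) := fun x hx =>
  ⟨_, by rintro _ ⟨y, rfl⟩; exact h.conj_bound hx (Nat.le_ceil x) y⟩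

theorem IsWeightSeq.youngConj_le {M : ℕ → ℝ} (h : IsWeightSeq M) {x : ℝ} (hx : 0 ≤ x) :
    youngConj (assocFun M) x ≤ Real.log (M ⌈x⌉₊) :=
  ciSup_le (h.conj_bound hx (Nat.le_ceil x))

theorem IsWeightSeq.mul_bound {M N : ℕ → ℝ} (hM : IsWeightSeq M) (hN : IsWeightSeq N) {t : ℝ}
    (ht : 0 < t) {s : ℝ} (hs : 0 < s) (p : ℕ) :
    p * Real.log t - Real.log ((M * N) p) ≤ assocFun M s + assocFun N (t / s) := by
  have h1 := hM.log_le hs p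
  have h2 := hN.log_le (div_pos ht hs) p
  rw [Real.log_div ht.ne' hs.ne'] at h2
  rw [Pi.mul_apply, Real.log_mul (hM.pos p).ne' (hN.pos p).ne']
  linarith

theorem IsWeightSeq.mul {M N : ℕ → ℝ} (hM : IsWeightSeq M) (hN : IsWeightSeq N) :
    IsWeightSeq (M * N) where
  one_le p := one_le_mul_of_one_le_of_one_le (hM.one_le p) (hN.one_le p)
  zero := by simp [hM.zero, hN.zero]
  bdd t ht := by
    refine ⟨assocFun M 1 + assocFun N (t / 1), ?_⟩
    rintro _ ⟨p, rfl⟩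
    have := hM.mul_bound hN ht one_pos p
    rwa [← Real.log_pow, ← Real.log_div (pow_pos ht p).ne'
      (show (M * N) p ≠ 0 from (mul_pos (hM.pos p) (hN.pos p)).ne')] at this

theorem IsWeightSeq.assocFun_mul_le {M N : ℕ → ℝ} (hM : IsWeightSeq M) (hN : IsWeightSeq N)
    {t : ℝ} (ht : 0 < t) : assocFun (M * N) t ≤ lowerConj (assocFun M) (assocFun N) t := by
  have : Nonempty (Ioi (0 : ℝ)) := ⟨⟨1, mem_Ioi.2 one_pos⟩⟩
  exact le_ciInf fun s => (hM.mul hN).assocFun_le ht (hM.mul_bound hN ht s.2)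

end Sequences

/-! ### Braun-Meise-Taylor weight functions -/

namespace IsBMTWeight

variable {σ : ℝ → ℝ} (hσ : IsBMTWeight σ)
include hσ

theorem nonneg {t : ℝ} (ht : 0 < t) : 0 ≤ σ t := by
  rw [← hσ.normalized 0 (by simp)]
  exact hσ.monotoneOn (by simp) ht.le ht.le

theorem hasConj : HasConj σ := by
  intro x hx
  -- For large `t` this gives `(x + 1) log t ≤ σ t`; `x + 1` instead of `x` also covers `x = 0`.
  have h := hσ.log_isLittleO.bound (show (0 : ℝ) < 1 / (x + 1) by positivity)
  obtain ⟨T, hT⟩ := eventually_atTop.1 h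
  set T' := max T 1
  have hT' : 1 ≤ T' := le_max_right _ _
  refine ⟨x * Real.log T', ?_⟩
  rintro _ ⟨y, rfl⟩
  have h0 := hσ.nonneg (Real.exp_pos y)
  have hlog : 0 ≤ Real.log T' := Real.log_nonneg hT'
  simp only
  rcases le_total T' (Real.exp y) with hy | hy
  · have h1 := hT (Real.exp y) ((le_max_left _ _).trans hy)
    rw [Real.log_exp, Real.norm_eq_abs, Real.norm_eq_abs, abs_of_nonneg h0, one_div,
      ← div_eq_inv_mul, le_div_iff₀ (by positivity)] at h1
    have hy0 : 0 ≤ y := by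
      rw [← Real.exp_le_exp, Real.exp_zero]
      exact hT'.trans hy
    rw [abs_of_nonneg hy0] at h1
    have := mul_nonneg hx hlog
    linarith
  · have h1 : y ≤ Real.log T' := by
      rwa [Real.le_log_iff_exp_le (one_pos.trans_le hT')]
    have := mul_le_mul_of_nonneg_left h1 hx
    linarith

theorem youngConj_zero : youngConj σ 0 = 0 := by
  refine le_antisymm (ciSup_le fun y => ?_) ?_
  · linarith [hσ.nonneg (Real.exp_pos y)]
  · simpa [hσ.normalized 1 (by simp)] using hσ.hasConj.le le_rfl 0

theorem youngConj_nonneg {x : ℝ} (hx : 0 ≤ x) : 0 ≤ youngConj σ x := by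
  simpa [hσ.normalized 1 (by simp)] using hσ.hasConj.le hx 0

theorem youngConj_mono {x y : ℝ} (hx : 0 ≤ x) (hxy : x ≤ y) : youngConj σ x ≤ youngConj σ y := by
  refine ciSup_le fun z => ?_
  rcases le_total 0 z with hz | hz
  · have := mul_le_mul_of_nonneg_right hxy hz
    linarith [hσ.hasConj.le (hx.trans hxy) z]
  · have := mul_nonpos_of_nonneg_of_nonpos hx hz
    linarith [hσ.nonneg (Real.exp_pos z), hσ.youngConj_nonneg (hx.trans hxy)]

theorem assocMatrix_bound {l : ℝ} (hl : 0 < l) {t : ℝ} (ht : 0 < t) (p : ℕ) :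
    p * Real.log t - Real.log (assocMatrix σ l p) ≤ 1 / l * σ t := by
  have h := hσ.hasConj.le_log (mul_nonneg hl.le p.cast_nonneg) ht
  have h1 := mul_le_mul_of_nonneg_left h (one_div_pos.2 hl).le
  have h2 : 1 / l * (l * p * Real.log t - σ t) = p * Real.log t - 1 / l * σ t := by
    field_simp
  rw [assocMatrix, Real.log_exp]
  linarith

theorem isWeightSeq_assocMatrix {l : ℝ} (hl : 0 < l) : IsWeightSeq (assocMatrix σ l) where
  one_le p := Real.one_le_exp (mul_nonneg (one_div_pos.2 hl).le
    (hσ.youngConj_nonneg (mul_nonneg hl.le p.cast_nonneg)))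
  zero := by simp [assocMatrix, hσ.youngConj_zero]
  bdd t ht := by
    refine ⟨1 / l * σ t, ?_⟩
    rintro _ ⟨p, rfl⟩
    have := hσ.assocMatrix_bound hl ht p
    rwa [← Real.log_pow, ← Real.log_div (pow_pos ht p).ne'
      (show assocMatrix σ l p ≠ 0 from (Real.exp_pos _).ne')] at this

theorem assocFun_assocMatrix_le {l : ℝ} (hl : 0 < l) {t : ℝ} (ht : 0 < t) :
    assocFun (assocMatrix σ l) t ≤ 1 / l * σ t :=
  (hσ.isWeightSeq_assocMatrix hl).assocFun_le ht (hσ.assocMatrix_bound hl ht)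

/-- The associated function is at most `σ / l`, whose conjugate is the left side, and conjugation
reverses order. -/
theorem le_youngConj_assocFun {l : ℝ} (hl : 0 < l) {x : ℝ} (hx : 0 ≤ x) :
    1 / l * youngConj σ (l * x) ≤ youngConj (assocFun (assocMatrix σ l)) x := by
  rw [one_div, inv_mul_le_iff₀ hl]
  refine ciSup_le fun y => ?_
  have h1 := (hσ.isWeightSeq_assocMatrix hl).hasConj.le hx y
  have h2 := hσ.assocFun_assocMatrix_le hl (Real.exp_pos y)
  rw [one_div, ← div_eq_inv_mul, le_div_iff₀ hl] at h2
  have h3 := mul_le_mul_of_nonneg_left h1 hl.le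
  linarith

/-- Rounding up shifts the argument by at most `l`; convexity absorbs the shift at the price of the
index `2 * l` and a constant. -/
theorem log_assocMatrix_ceil_le {l : ℝ} (hl : 0 < l) {x : ℝ} (hx : 0 ≤ x) :
    Real.log (assocMatrix σ l ⌈x⌉₊) ≤
      1 / (2 * l) * youngConj σ (2 * l * x) + 1 / (2 * l) * youngConj σ (2 * l) := by
  have h1 : youngConj σ (l * ⌈x⌉₊) ≤ youngConj σ (l * x + l) := by
    refine hσ.youngConj_mono (by positivity) ?_
    have := mul_le_mul_of_nonneg_left (Nat.ceil_lt_add_one hx).le hl.le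
    linarith
  have h2 := h1.trans (youngConj_add_le hσ.hasConj (mul_nonneg hl.le hx) hl.le)
  have h3 := mul_le_mul_of_nonneg_left h2 (one_div_pos.2 hl).le
  rw [assocMatrix, Real.log_exp]
  refine h3.trans (le_of_eq ?_)
  rw [mul_assoc]
  field_simp

end IsBMTWeight

/-! ### Gevrey sequences and powers -/

section Gevrey

theorem log_factorial_le (q : ℕ) : Real.log (q ! : ℝ) ≤ q * Real.log q := by
  rw [← Real.log_pow]
  exact Real.log_le_log (by positivity) (by exact_mod_cast Nat.factorial_le_pow q)

/-- A single term of the exponential series: `q^q / q! ≤ e^q`. -/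
theorem le_log_factorial (q : ℕ) : q * Real.log q - q ≤ Real.log (q ! : ℝ) := by
  rcases q.eq_zero_or_pos with rfl | hq
  · simp
  have h := Real.log_le_log (by positivity) (Real.pow_div_factorial_le_exp (q : ℝ) (by positivity) q)
  rw [Real.log_exp, Real.log_div (by positivity) (by positivity), Real.log_pow] at h
  linarith

theorem log_factorial_ceil_le {x : ℝ} (hx : 0 ≤ x) :
    Real.log (⌈x⌉₊ ! : ℝ) ≤ x * Real.log (2 * x) + Real.log 2 := by
  have h1 : (⌈x⌉₊ : ℝ) * Real.log ⌈x⌉₊ ≤ (x + 1) * Real.log (x + 1) := by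
    rcases Nat.eq_zero_or_pos ⌈x⌉₊ with h | h
    · rw [h, Nat.cast_zero, zero_mul]
      exact mul_nonneg (by linarith) (Real.log_nonneg (by linarith))
    · have h1 : (1 : ℝ) ≤ ⌈x⌉₊ := by exact_mod_cast h
      have h2 := (Nat.ceil_lt_add_one hx).le
      exact mul_le_mul h2 (Real.log_le_log (by linarith) h2) (Real.log_nonneg h1) (by linarith)
  -- The point `x + 1` is the midpoint of `2 * x` and `2`.
  have h2 := Real.convexOn_mul_log.2 (mem_Ici.2 (mul_nonneg zero_le_two hx))
    (mem_Ici.2 zero_le_two) (show (0 : ℝ) ≤ 1 / 2 by norm_num)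
    (show (0 : ℝ) ≤ 1 / 2 by norm_num) (by norm_num)
  simp only [smul_eq_mul] at h2
  have h3 : 1 / 2 * (2 * x) + 1 / 2 * 2 = x + 1 := by ring
  rw [h3] at h2
  linarith [log_factorial_le ⌈x⌉₊]

theorem log_gevrey (α : ℝ) (p : ℕ) : Real.log (gevrey α p) = α * Real.log (p ! : ℝ) :=
  Real.log_rpow (by positivity) _

theorem gevrey_pos (α : ℝ) (p : ℕ) : 0 < gevrey α p :=
  Real.rpow_pos_of_pos (by positivity) _

theorem gevrey_bound {α : ℝ} (hα : 0 < α) {t : ℝ} (ht : 0 < t) (p : ℕ) :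
    p * Real.log t - Real.log (gevrey α p) ≤ α * t ^ (1 / α) := by
  have hs : 0 < t ^ (1 / α) := Real.rpow_pos_of_pos ht _
  have h := Real.log_le_log (by positivity) (Real.pow_div_factorial_le_exp (t ^ (1 / α)) hs.le p)
  rw [Real.log_exp, Real.log_div (by positivity) (by positivity), Real.log_pow,
    Real.log_rpow ht] at h
  have h1 := mul_le_mul_of_nonneg_left h hα.le
  have h2 : α * (p * (1 / α * Real.log t) - Real.log (p ! : ℝ)) =
      p * Real.log t - α * Real.log (p ! : ℝ) := by
    field_simp
  rw [log_gevrey]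
  linarith

theorem isWeightSeq_gevrey {α : ℝ} (hα : 0 < α) : IsWeightSeq (gevrey α) where
  one_le p := Real.one_le_rpow (by exact_mod_cast Nat.succ_le_of_lt (Nat.factorial_pos p)) hα.le
  zero := by simp [gevrey]
  bdd t ht := by
    refine ⟨α * t ^ (1 / α), ?_⟩
    rintro _ ⟨p, rfl⟩
    have := gevrey_bound hα ht p
    rwa [← Real.log_pow, ← Real.log_div (pow_pos ht p).ne' (gevrey_pos α p).ne'] at this

/-- The conjugate of a weight that is bounded by a multiple of `t^(1/α)`. -/
theorem le_youngConj_of_le_rpow {ω : ℝ → ℝ} (h : HasConj ω) {α c : ℝ} (hα : 0 < α) (hc : 0 < c)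
    (hle : ∀ t > 0, ω t ≤ c * t ^ (1 / α)) {x : ℝ} (hx : 0 ≤ x) :
    α * x * Real.log (α / c * Real.exp (-1) * x) - c ≤ youngConj ω x := by
  rcases hx.eq_or_lt with rfl | hx
  -- Only the case `x = 0` needs the term `-c`.
  · have h1 := h.le le_rfl 0
    have h2 := hle 1 one_pos
    simp only [Real.exp_zero, mul_zero, zero_sub, Real.one_rpow, mul_one] at h1 h2 ⊢
    linarith
  · have hu : 0 < α * x / c := by positivity
    have hpos : 0 < (α * x / c) ^ α := Real.rpow_pos_of_pos hu α
    have h1 := h.le_log hx.le hpos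
    have h2 := hle _ hpos
    rw [← Real.rpow_mul hu.le, mul_one_div_cancel hα.ne', Real.rpow_one,
      mul_div_cancel₀ _ hc.ne'] at h2
    rw [Real.log_rpow hu] at h1
    have h3 : α / c * Real.exp (-1) * x = α * x / c * Real.exp (-1) := by ring
    rw [h3, Real.log_mul hu.ne' (Real.exp_pos _).ne', Real.log_exp]
    linarith

theorem idPow_bound {α : ℝ} (hα : 0 < α) {x : ℝ} (hx : 0 ≤ x) (y : ℝ) :
    x * y - idPow (1 / α) (Real.exp y) ≤ α * x * Real.log (α * x) := by
  rw [idPow, ← Real.exp_mul]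
  rcases hx.eq_or_lt with rfl | hx
  · simp [(Real.exp_pos _).le]
  · have hu : 0 < α * x := by positivity
    -- Tangent line of `exp` at the maximizer `y / α = log (α x)`.
    have h1 := Real.add_one_le_exp (y * (1 / α) - Real.log (α * x))
    rw [Real.exp_sub, Real.exp_log hu, le_div_iff₀ hu] at h1
    have h2 : (y * (1 / α) - Real.log (α * x) + 1) * (α * x) =
        x * y - α * x * Real.log (α * x) + α * x := by
      field_simp
    linarith

theorem hasConj_idPow {α : ℝ} (hα : 0 < α) : HasConj (idPow (1 / α)) := fun x hx =>
  ⟨_, by rintro _ ⟨y, rfl⟩; exact idPow_bound hα hx y⟩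

theorem youngConj_idPow_le {α : ℝ} (hα : 0 < α) {x : ℝ} (hx : 0 ≤ x) :
    youngConj (idPow (1 / α)) x ≤ α * x * Real.log (α * x) :=
  ciSup_le (idPow_bound hα hx)

theorem le_youngConj_idPow {α : ℝ} (hα : 0 < α) {x : ℝ} (hx : 0 ≤ x) :
    α * x * Real.log (α * Real.exp (-1) * x) - 1 ≤ youngConj (idPow (1 / α)) x := by
  simpa using le_youngConj_of_le_rpow (hasConj_idPow hα) hα one_pos (fun t _ => by simp [idPow]) hx

theorem youngConj_assocFun_gevrey_le {α : ℝ} (hα : 0 < α) {x : ℝ} (hx : 0 ≤ x) :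
    youngConj (assocFun (gevrey α)) x ≤ α * x * Real.log (2 * x) + α * Real.log 2 := by
  have h := (isWeightSeq_gevrey hα).youngConj_le hx
  rw [log_gevrey] at h
  have := mul_le_mul_of_nonneg_left (log_factorial_ceil_le hx) hα.le
  linarith

theorem le_youngConj_assocFun_gevrey {α : ℝ} (hα : 0 < α) {x : ℝ} (hx : 0 ≤ x) :
    α * x * Real.log (Real.exp (-1) * x) - α ≤ youngConj (assocFun (gevrey α)) x := by
  have := le_youngConj_of_le_rpow (isWeightSeq_gevrey hα).hasConj hα hα
    (fun t ht => (isWeightSeq_gevrey hα).assocFun_le ht (gevrey_bound hα ht)) hx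
  rwa [div_self hα.ne', one_mul] at this

end Gevrey

/-! ### Comparison of weight functions with the matrix `(h^p S^(x)_p p!^α)` -/

section Families

theorem mul_log_mul_natCast {c : ℝ} (hc : 0 < c) (p : ℕ) :
    p * Real.log (c * p) = p * Real.log c + p * Real.log p := by
  rcases p.eq_zero_or_pos with rfl | hp
  · simp
  · rw [Real.log_mul hc.ne' (by positivity)]
    ring

theorem matrixWeight_eq_exp (σ : ℝ → ℝ) (α : ℝ) (x : ℝ) {h : ℝ} (hh : 0 < h) (p : ℕ) :
    h ^ p * (assocMatrix σ x * gevrey α) p =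
      Real.exp (p * Real.log h + (1 / x * youngConj σ (x * p) + α * Real.log (p ! : ℝ))) := by
  rw [Real.exp_add, Real.exp_add, ← Real.log_pow, Real.exp_log (pow_pos hh p), ← log_gevrey,
    Real.exp_log (gevrey_pos α p)]
  rfl

theorem matrixWeight_dominated {σ : ℝ → ℝ} (hσ : IsBMTWeight σ) (α : ℝ) {x x' h h' : ℝ}
    (hx : 0 < x) (hxx : x ≤ x') (hh : 0 < h) (hhh : h ≤ h') :
    Dominated (fun p => h ^ p * (assocMatrix σ x * gevrey α) p)
      (fun p => h' ^ p * (assocMatrix σ x' * gevrey α) p) := by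
  refine ⟨1, one_pos, fun p => ?_⟩
  have hh' := hh.trans_le hhh
  simp only [one_mul, matrixWeight_eq_exp σ α _ hh, matrixWeight_eq_exp σ α _ hh',
    Real.exp_pos, Real.exp_le_exp, true_and]
  have h1 := youngConj_scale_mono (fun t ht => hσ.nonneg ht) hσ.hasConj hx hxx p.cast_nonneg
  have h2 := mul_le_mul_of_nonneg_left (Real.log_le_log hh hhh) p.cast_nonneg
  linarith

theorem dominated_exp {f g : ℕ → ℝ} (C : ℝ) (h : ∀ p, f p ≤ g p + C) :
    Dominated (fun p => Real.exp (f p)) (fun p => Real.exp (g p)) :=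
  ⟨Real.exp C, Real.exp_pos C, fun p => ⟨Real.exp_pos _, by
    rw [← Real.exp_add, Real.exp_le_exp, add_comm]; exact h p⟩⟩

/-- One small `k` pushes the index and the geometric factor below prescribed values;
`exists_le_scale` does the opposite with a large `k`. -/
theorem exists_scale_le {α b e : ℝ} (hα : 0 < α) (hb : 0 < b) (he : 0 < e) {x h : ℝ} (hx : 0 < x)
    (hh : 0 < h) : ∃ k > 0, b * k ≤ x ∧ (e * k) ^ α ≤ h := by
  have hr := Real.rpow_pos_of_pos hh (1 / α)
  refine ⟨min (x / b) (h ^ (1 / α) / e), lt_min (by positivity) (by positivity), ?_, ?_⟩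
  · rw [mul_comm, ← le_div_iff₀ hb]
    exact min_le_left _ _
  · have h1 : e * min (x / b) (h ^ (1 / α) / e) ≤ h ^ (1 / α) := by
      rw [mul_comm, ← le_div_iff₀ he]
      exact min_le_right _ _
    refine (Real.rpow_le_rpow (by positivity) h1 hα.le).trans (le_of_eq ?_)
    rw [← Real.rpow_mul hh.le, one_div_mul_cancel hα.ne', Real.rpow_one]

theorem exists_le_scale {α b e : ℝ} (hα : 0 < α) (hb : 0 < b) (he : 0 < e) {x h : ℝ} (hx : 0 < x)
    (hh : 0 < h) : ∃ k > 0, x ≤ b * k ∧ h ≤ (e * k) ^ α := by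
  have hr := Real.rpow_pos_of_pos hh (1 / α)
  refine ⟨max (x / b) (h ^ (1 / α) / e), lt_max_of_lt_left (by positivity), ?_, ?_⟩
  · rw [mul_comm, ← div_le_iff₀ hb]
    exact le_max_left _ _
  · have h1 : h ^ (1 / α) ≤ e * max (x / b) (h ^ (1 / α) / e) := by
      rw [mul_comm, ← div_le_iff₀ he]
      exact le_max_right _ _
    refine (le_of_eq ?_).trans (Real.rpow_le_rpow hr.le h1 hα.le)
    rw [← Real.rpow_mul hh.le, one_div_mul_cancel hα.ne', Real.rpow_one]

theorem weightsLE_matrixWeights {σ ω : ℝ → ℝ} (hσ : IsBMTWeight σ) {α b e C : ℝ} (hα : 0 < α)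
    (hb : 0 < b) (he : 0 < e) (H : ∀ x, 0 ≤ x → youngConj ω x ≤
      1 / b * youngConj σ (b * x) + α * x * Real.log (e * x) + C) :
    WeightsLE (functionWeights ω) (matrixWeights fun x => assocMatrix σ x * gevrey α) := by
  -- The factor `Real.exp 1` comes from `p log p ≤ log p! + p`.
  have key : ∀ k > 0, Dominated (assocMatrix ω k)
      (fun p => ((e * Real.exp 1 * k) ^ α) ^ p * (assocMatrix σ (b * k) * gevrey α) p) := by
    intro k hk
    have hr : 0 < (e * Real.exp 1 * k) ^ α := Real.rpow_pos_of_pos (by positivity) _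
    simp only [matrixWeight_eq_exp σ α _ hr]
    refine dominated_exp (1 / k * C) fun p => ?_
    have h1 := mul_le_mul_of_nonneg_left (H (k * p) (by positivity)) (one_div_pos.2 hk).le
    have h2 : 1 / k * (1 / b * youngConj σ (b * (k * p)) + α * (k * p) * Real.log (e * (k * p)) + C)
        = 1 / (b * k) * youngConj σ (b * k * p) + α * (p * Real.log (e * k * p)) + 1 / k * C := by
      rw [← mul_assoc b, ← mul_assoc e]
      field_simp
    rw [h2, mul_log_mul_natCast (mul_pos he hk)] at h1
    have h3 := mul_le_mul_of_nonneg_left (le_log_factorial p) hα.le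
    rw [Real.log_rpow (by positivity), mul_right_comm e,
      Real.log_mul (by positivity) (Real.exp_pos 1).ne', Real.log_exp]
    linarith
  constructor
  · rintro _ ⟨k, hk, rfl⟩
    exact ⟨_, ⟨b * k, mul_pos hb hk, _, Real.rpow_pos_of_pos (by positivity) _, rfl⟩, key k hk⟩
  · rintro _ ⟨x, hx, h, hh, rfl⟩
    obtain ⟨k, hk, h1, h2⟩ := exists_scale_le (e := e * Real.exp 1) hα hb (by positivity) hx hh
    exact ⟨_, ⟨k, hk, rfl⟩, (key k hk).trans (matrixWeight_dominated hσ α (mul_pos hb hk) h1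
      (Real.rpow_pos_of_pos (by positivity) _) h2)⟩

theorem matrixWeights_weightsLE {σ ω : ℝ → ℝ} (hσ : IsBMTWeight σ) {α b e C : ℝ} (hα : 0 < α)
    (hb : 0 < b) (he : 0 < e) (H : ∀ x, 0 ≤ x →
      1 / b * youngConj σ (b * x) + α * x * Real.log (e * x) - C ≤ youngConj ω x) :
    WeightsLE (matrixWeights fun x => assocMatrix σ x * gevrey α) (functionWeights ω) := by
  -- Here `log p! ≤ p log p` suffices, with no extra exponential factor.
  have key : ∀ k > 0, Dominated
      (fun p => ((e * k) ^ α) ^ p * (assocMatrix σ (b * k) * gevrey α) p) (assocMatrix ω k) := by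
    intro k hk
    have hr : 0 < (e * k) ^ α := Real.rpow_pos_of_pos (by positivity) _
    simp only [matrixWeight_eq_exp σ α _ hr]
    refine dominated_exp (1 / k * C) fun p => ?_
    have h1 := mul_le_mul_of_nonneg_left (H (k * p) (by positivity)) (one_div_pos.2 hk).le
    have h2 : 1 / k * (1 / b * youngConj σ (b * (k * p)) + α * (k * p) * Real.log (e * (k * p)) - C)
        = 1 / (b * k) * youngConj σ (b * k * p) + α * (p * Real.log (e * k * p)) - 1 / k * C := by
      rw [← mul_assoc b, ← mul_assoc e]
      field_simp
    rw [h2, mul_log_mul_natCast (mul_pos he hk)] at h1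
    have h3 := mul_le_mul_of_nonneg_left (log_factorial_le p) hα.le
    rw [Real.log_rpow (by positivity)]
    linarith
  constructor
  · rintro _ ⟨x, hx, h, hh, rfl⟩
    obtain ⟨k, hk, h1, h2⟩ := exists_le_scale hα hb he hx hh
    exact ⟨_, ⟨k, hk, rfl⟩, (matrixWeight_dominated hσ α hx h1 hh h2).trans (key k hk)⟩
  · rintro _ ⟨k, hk, rfl⟩
    exact ⟨_, ⟨b * k, mul_pos hb hk, _, Real.rpow_pos_of_pos (by positivity) _, rfl⟩, key k hk⟩

/-- `ω` and the matrix `(h^p S^(x)_p p!^α)` have equivalent weight sequences. -/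
def MatrixEquiv (σ : ℝ → ℝ) (α : ℝ) (ω : ℝ → ℝ) : Prop :=
  WeightsLE (functionWeights ω) (matrixWeights fun x => assocMatrix σ x * gevrey α) ∧
  WeightsLE (matrixWeights fun x => assocMatrix σ x * gevrey α) (functionWeights ω)

theorem MatrixEquiv.sameSpaces {σ ω τ : ℝ → ℝ} {α : ℝ} (h : MatrixEquiv σ α ω)
    (h' : MatrixEquiv σ α τ) : SameSpaces.{u, v} (functionWeights ω) (functionWeights τ) :=
  (h.1.trans h'.2).sameSpaces (h'.1.trans h.2)

/-! ### Equivalence of the individual weight functions with the matrix -/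

variable {σ : ℝ → ℝ} (hσ : IsBMTWeight σ) {α l : ℝ} (hα : 0 < α) (hl : 0 < l)
include hσ hα

theorem matrixEquiv_lowerConj_idPow : MatrixEquiv σ α (lowerConj σ (idPow (1 / α))) := by
  have hy : ∀ x, 0 ≤ x → youngConj (lowerConj σ (idPow (1 / α))) x =
      youngConj σ x + youngConj (idPow (1 / α)) x := fun x hx =>
    youngConj_lowerConj (fun t ht => hσ.nonneg ht) (fun t ht => (Real.rpow_pos_of_pos ht _).le)
      hσ.hasConj (hasConj_idPow hα) hx
  refine ⟨weightsLE_matrixWeights hσ (b := 1) (e := α) (C := 0) hα one_pos hα fun x hx => ?_,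
    matrixWeights_weightsLE hσ (b := 1) (e := α * Real.exp (-1)) (C := 1) hα one_pos
      (by positivity) fun x hx => ?_⟩
  · rw [hy x hx, one_mul, div_one, one_mul]
    linarith [youngConj_idPow_le hα hx]
  · rw [hy x hx, one_mul, div_one, one_mul]
    linarith [le_youngConj_idPow hα hx]

theorem matrixEquiv_lowerConj_gevrey : MatrixEquiv σ α (lowerConj σ (assocFun (gevrey α))) := by
  have hy : ∀ x, 0 ≤ x → youngConj (lowerConj σ (assocFun (gevrey α))) x =
      youngConj σ x + youngConj (assocFun (gevrey α)) x := fun x hx =>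
    youngConj_lowerConj (fun t ht => hσ.nonneg ht)
      (fun t ht => (isWeightSeq_gevrey hα).assocFun_nonneg ht)
      hσ.hasConj (isWeightSeq_gevrey hα).hasConj hx
  refine ⟨weightsLE_matrixWeights hσ (b := 1) (e := 2) (C := α * Real.log 2) hα one_pos two_pos
    fun x hx => ?_, matrixWeights_weightsLE hσ (b := 1) (e := Real.exp (-1)) (C := α) hα one_pos
      (by positivity) fun x hx => ?_⟩
  · rw [hy x hx, one_mul, div_one, one_mul]
    linarith [youngConj_assocFun_gevrey_le hα hx]
  · rw [hy x hx, one_mul, div_one, one_mul]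
    linarith [le_youngConj_assocFun_gevrey hα hx]

include hl

theorem youngConj_lowerConj_assocFun {x : ℝ} (hx : 0 ≤ x) :
    youngConj (lowerConj (assocFun (assocMatrix σ l)) (assocFun (gevrey α))) x =
      youngConj (assocFun (assocMatrix σ l)) x + youngConj (assocFun (gevrey α)) x :=
  youngConj_lowerConj (fun _ ht => (hσ.isWeightSeq_assocMatrix hl).assocFun_nonneg ht)
    (fun _ ht => (isWeightSeq_gevrey hα).assocFun_nonneg ht)
    (hσ.isWeightSeq_assocMatrix hl).hasConj (isWeightSeq_gevrey hα).hasConj hx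

theorem matrixEquiv_lowerConj_assocFun :
    MatrixEquiv σ α (lowerConj (assocFun (assocMatrix σ l)) (assocFun (gevrey α))) := by
  refine ⟨weightsLE_matrixWeights hσ (b := 2 * l) (e := 2)
    (C := 1 / (2 * l) * youngConj σ (2 * l) + α * Real.log 2) hα (by positivity) two_pos
    fun x hx => ?_, matrixWeights_weightsLE hσ (b := l) (e := Real.exp (-1)) (C := α) hα hl
      (by positivity) fun x hx => ?_⟩
  · rw [youngConj_lowerConj_assocFun hσ hα hl hx]
    linarith [youngConj_assocFun_gevrey_le hα hx,
      ((hσ.isWeightSeq_assocMatrix hl).youngConj_le hx).trans (hσ.log_assocMatrix_ceil_le hl hx)]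
  · rw [youngConj_lowerConj_assocFun hσ hα hl hx]
    linarith [le_youngConj_assocFun_gevrey hα hx, hσ.le_youngConj_assocFun hl hx]

/-- The upper bound evaluates the product sequence at `⌈x⌉₊`. The lower bound follows from `ω_{M N}
≤ lowerConj ω_M ω_N`, as conjugation reverses order. -/
theorem matrixEquiv_assocFun_mul : MatrixEquiv σ α (assocFun (assocMatrix σ l * gevrey α)) := by
  have hM := hσ.isWeightSeq_assocMatrix hl
  have hG := isWeightSeq_gevrey hα
  refine ⟨weightsLE_matrixWeights hσ (b := 2 * l) (e := 2)
    (C := 1 / (2 * l) * youngConj σ (2 * l) + α * Real.log 2) hα (by positivity) two_pos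
    fun x hx => ?_, matrixWeights_weightsLE hσ (b := l) (e := Real.exp (-1)) (C := α) hα hl
      (by positivity) fun x hx => ?_⟩
  · have h := (hM.mul hG).youngConj_le hx
    rw [Pi.mul_apply, Real.log_mul (hM.pos _).ne' (gevrey_pos _ _).ne', log_gevrey] at h
    have := mul_le_mul_of_nonneg_left (log_factorial_ceil_le hx) hα.le
    linarith [hσ.log_assocMatrix_ceil_le hl hx]
  · have h := youngConj_anti (hM.mul hG).hasConj (fun t ht => hM.assocFun_mul_le hG ht) hx
    rw [youngConj_lowerConj_assocFun hσ hα hl hx] at h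
    linarith [le_youngConj_assocFun_gevrey hα hx, hσ.le_youngConj_assocFun hl hx]

end Families

/-- The substitution `s = u^(-α)` in the infimum that defines the envelope. -/
theorem powSubst_lowerEnvelope {σ : ℝ → ℝ} {α : ℝ} (hα : 0 < α) {t : ℝ} (ht : 0 < t) :
    powSubst (lowerEnvelope (powSubst (inversion σ) α)) (1 / α) t =
      lowerConj σ (idPow (1 / α)) t := by
  let e : Ioi (0 : ℝ) → Ioi (0 : ℝ) := fun u => ⟨1 / (u : ℝ) ^ α,
    one_div_pos.2 (Real.rpow_pos_of_pos u.2 α)⟩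
  have he : Function.Surjective e := by
    intro s
    have hs : (0 : ℝ) < s := s.2
    -- Inverse substitution `u = s^(-1/α)`.
    refine ⟨⟨(1 / (s : ℝ)) ^ (1 / α), Real.rpow_pos_of_pos (one_div_pos.2 hs) _⟩, Subtype.ext ?_⟩
    simp only [e]
    rw [← Real.rpow_mul (one_div_pos.2 hs).le, one_div_mul_cancel hα.ne', Real.rpow_one, one_div_one_div]
  unfold powSubst lowerEnvelope lowerConj
  refine Eq.trans (iInf_congr fun u => ?_)
    (he.iInf_comp fun s : Ioi (0 : ℝ) => σ s + idPow (1 / α) (t / s))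
  have hu : (0 : ℝ) < u := u.2
  simp only [e, inversion, idPow]
  rw [div_div_eq_mul_div, div_one, Real.mul_rpow ht.le (Real.rpow_pos_of_pos hu α).le,
    ← Real.rpow_mul hu.le, mul_one_div_cancel hα.ne', Real.rpow_one]

/-- The conjugate samples `ω` only at `e^y > 0`, so the value at `0` is irrelevant. -/
theorem functionWeights_congr {ω τ : ℝ → ℝ} (h : ∀ t > 0, ω t = τ t) :
    functionWeights ω = functionWeights τ := by
  have : assocMatrix ω = assocMatrix τ := by
    unfold assocMatrix
    rw [youngConj_congr h]
  simp only [functionWeights, this]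

end WeightedSpaces

theorem corollary3p3 (σ : ℝ → ℝ) (hσ : IsBMTWeight σ)
    (α : ℝ) (hα : 0 < α) (l : ℝ) (hl : 0 < l) :
    SameSpaces.{u, v}
      (matrixWeights fun x =>
        assocMatrix σ x * gevrey α)
      (functionWeights (assocFun
        (assocMatrix σ l * gevrey α))) ∧
    SameSpaces.{u, v}
      (functionWeights (assocFun
        (assocMatrix σ l * gevrey α)))
      (functionWeights (lowerConj
        (assocFun (assocMatrix σ l))
        (assocFun (gevrey α)))) ∧
    SameSpaces.{u, v}
      (functionWeights (lowerConj
        (assocFun (assocMatrix σ l))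
        (assocFun (gevrey α))))
      (functionWeights (lowerConj σ
        (assocFun (gevrey α)))) ∧
    SameSpaces.{u, v}
      (functionWeights (lowerConj σ
        (assocFun (gevrey α))))
      (functionWeights (lowerConj σ
        (idPow (1 / α)))) ∧
    SameSpaces.{u, v}
      (functionWeights (lowerConj σ
        (idPow (1 / α))))
      (functionWeights (powSubst
        (lowerEnvelope
          (powSubst (inversion σ) α)) (1 / α))) := by
  have h₁ := matrixEquiv_assocFun_mul hσ hα hl
  have h₂ := matrixEquiv_lowerConj_assocFun hσ hα hl
  have h₃ := matrixEquiv_lowerConj_gevrey hσ hα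
  have h₄ := matrixEquiv_lowerConj_idPow hσ hα
  refine ⟨h₁.2.sameSpaces h₁.1, h₁.sameSpaces h₂, h₂.sameSpaces h₃, h₃.sameSpaces h₄, ?_⟩
  rw [functionWeights_congr fun t ht => powSubst_lowerEnvelope (σ := σ) hα ht]
  exact h₄.sameSpaces h₄
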